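/- Let $\omega>0$ and $T=2\pi/\omega$. Let $-\infty\le f_{\min}<0$ and let $f:\,]-1,+\infty[\,\to\,]f_{\min},+\infty[$ be a twice continuously differentiable function onto $]f_{\min},+\infty[$ such that $\lim_{y\to-1}f(y)=+\infty$, $f(0)=0$, $f'(0)=-1$ and $f'(y)<0<f''(y)$ for all $y>-1$. For every $A\ge 0$ the differential equation $$\frac{dy}{dt}=f(y)+A\sin\omega t$$ has exactly one $T$-periodic solution $Y(\cdot,A):\mathbb{R}\to\,]-1,+\infty[$. This solution has a maximum $Y_{\max}(A)=\max_{t\in[0,T]}Y(t,A)$ over one period, and: 1. $Y_{\max}$ is a strictly increasing convex function of $A\in[0,+\infty[$. 2. For all $A>0$, $$\max\left(\frac{A}{\sqrt{1+\omega^2}},\ \frac{A}{\omega}\,\frac{1}{\sqrt{1+\omega^2}}-\frac T2\,|f_{\min}|\right)<Y_{\max}(A)<\frac{2A}{\omega},$$ where the second term in the maximum is $-\infty$ if $f_{\min}=-\infty$. 3. As $A\to0^+$, $\displaystyle Y_{\max}(A)=\frac{A}{\sqrt{1+\omega^2}}+O(A^2)$, where the implied constant may depend on $f$ and $\omega$.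 -/

import Mathlib

open Set Filter Topology Asymptotics
open scoped ENNReal

/-- The standing hypotheses on the nonlinearity `f : ]-1, +∞[ → ]fmin, +∞[` with
`-∞ ≤ fmin < 0` (so `fmin` is an extended real). The values of `f` outside `]-1, +∞[`
are irrelevant. -/
structure IsContactLaw (f : ℝ → ℝ) (fmin : EReal) : Prop where
  /-- `f` is twice continuously differentiable on `]-1, +∞[`. -/
  contDiffOn : ContDiffOn ℝ 2 f (Ioi (-1))
  fmin_neg : fmin < 0
  /-- `f` maps `]-1, +∞[` onto `]fmin, +∞[`. -/
  image_eq : (fun y : ℝ => (f y : EReal)) '' Ioi (-1) = Ioo fmin ⊤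
  tendsto_neg_one : Tendsto f (𝓝[>] (-1)) atTop
  map_zero : f 0 = 0
  deriv_zero : deriv f 0 = -1
  deriv_neg : ∀ y : ℝ, -1 < y → deriv f y < 0
  deriv_deriv_pos : ∀ y : ℝ, -1 < y → 0 < deriv (deriv f) y

/-- `y` is a solution, with values in `]-1, +∞[`, of `y'(t) = f (y t) + A sin (ω t)`,
periodic with period `T = 2π / ω`. -/
structure IsPeriodicSolution (f : ℝ → ℝ) (ω A : ℝ) (y : ℝ → ℝ) : Prop where
  neg_one_lt : ∀ t : ℝ, -1 < y t
  hasDerivAt : ∀ t : ℝ, HasDerivAt y (f (y t) + A * Real.sin (ω * t)) t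
  periodic : Function.Periodic y (2 * Real.pi / ω)

/-! ### Extrema of periodic functions -/

theorem nonneg_of_periodic {d d' : ℝ → ℝ} {T : ℝ} (hT : 0 < T) (hper : Function.Periodic d T)
    (hd : ∀ t, HasDerivAt d (d' t) t) (h : ∀ t, d' t = 0 → 0 ≤ d t) (t : ℝ) : 0 ≤ d t := by
  have hc : Continuous d := continuous_iff_continuousAt.2 fun t => (hd t).continuousAt
  obtain ⟨s, -, hs⟩ := isCompact_Icc.exists_isMinOn (nonempty_Icc.2 hT.le) hc.continuousOn
    (s := Icc 0 T)
  have hmin : ∀ r, d s ≤ d r := by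
    intro r
    obtain ⟨q, hq, hqr⟩ := hper.exists_mem_Ico₀ hT r
    rw [hqr]
    exact hs (Ico_subset_Icc_self hq)
  have h0 : d' s = 0 :=
    IsLocalMin.hasDerivAt_eq_zero (Eventually.of_forall hmin) (hd s)
  exact (h s h0).trans (hmin t)

/-! ### A periodic Green operator -/

section Green

open intervalIntegral BoundedContinuousFunction

theorem integral_exp_mul_le {L T M : ℝ} (hL : 0 < L) (hT : 0 < T) {w : ℝ → ℝ}
    (hw : ∀ s, |w s| ≤ M) :
    |(Real.exp (L * T) - 1)⁻¹ * ∫ s in (0 : ℝ)..T, Real.exp (L * s) * w s| ≤ M / L := by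
  have hpos : 0 < Real.exp (L * T) - 1 := by
    have := Real.add_one_lt_exp (mul_pos hL hT).ne'
    have := mul_pos hL hT
    linarith
  have hint : ∫ s in (0 : ℝ)..T, Real.exp (L * s) * M = (Real.exp (L * T) - 1) / L * M := by
    rw [intervalIntegral.integral_mul_const, intervalIntegral.integral_comp_mul_left _ hL.ne']
    rw [integral_exp, mul_zero, Real.exp_zero, smul_eq_mul]
    ring
  have hb : ‖∫ s in (0 : ℝ)..T, Real.exp (L * s) * w s‖ ≤
      ∫ s in (0 : ℝ)..T, Real.exp (L * s) * M := by
    refine norm_integral_le_of_norm_le hT.le (Eventually.of_forall fun s _ => ?_)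
      (Continuous.intervalIntegrable (by fun_prop) _ _)
    rw [norm_mul, Real.norm_eq_abs, Real.norm_eq_abs, Real.abs_exp]
    exact mul_le_mul_of_nonneg_left (hw s) (Real.exp_pos _).le
  rw [hint, Real.norm_eq_abs] at hb
  rw [abs_mul, abs_of_pos (inv_pos.2 hpos)]
  calc _ ≤ (Real.exp (L * T) - 1)⁻¹ * ((Real.exp (L * T) - 1) / L * M) :=
        mul_le_mul_of_nonneg_left hb (inv_pos.2 hpos).le
    _ = M / L := by field_simp

/-- The bounded solution of `y' = -L y + u` for `T`-periodic `u`, as an operator on all bounded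
continuous functions. -/
noncomputable def green (L T : ℝ) (hL : 0 < L) (hT : 0 < T) (u : ℝ →ᵇ ℝ) : ℝ →ᵇ ℝ :=
  BoundedContinuousFunction.ofNormedAddCommGroup
    (fun t => (Real.exp (L * T) - 1)⁻¹ * ∫ s in (0 : ℝ)..T, Real.exp (L * s) * u (t + s))
    (continuous_const.mul
      (intervalIntegral.continuous_parametric_intervalIntegral_of_continuous' (by fun_prop) _ _))
    (‖u‖ / L)
    (fun t => integral_exp_mul_le hL hT fun s => u.norm_coe_le_norm (t + s))

theorem green_apply (L T : ℝ) (hL : 0 < L) (hT : 0 < T) (u : ℝ →ᵇ ℝ) (t : ℝ) :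
    green L T hL hT u t =
      (Real.exp (L * T) - 1)⁻¹ * ∫ s in (0 : ℝ)..T, Real.exp (L * s) * u (t + s) := rfl

theorem dist_green_le (L T : ℝ) (hL : 0 < L) (hT : 0 < T) (u v : ℝ →ᵇ ℝ) :
    dist (green L T hL hT u) (green L T hL hT v) ≤ dist u v / L := by
  refine (BoundedContinuousFunction.dist_le (by positivity)).2 fun t => ?_
  rw [Real.dist_eq, green_apply, green_apply, ← mul_sub, ← intervalIntegral.integral_sub
    (Continuous.intervalIntegrable (by fun_prop) _ _)
    (Continuous.intervalIntegrable (by fun_prop) _ _)]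
  simp_rw [← mul_sub]
  exact integral_exp_mul_le hL hT fun s => u.dist_coe_le_dist (g := v) (t + s)

theorem hasDerivAt_green (L T : ℝ) (hL : 0 < L) (hT : 0 < T) (u : ℝ →ᵇ ℝ)
    (hu : Function.Periodic u T) (t : ℝ) :
    HasDerivAt (green L T hL hT u) (-L * green L T hL hT u t + u t) t := by
  have hpos : 0 < Real.exp (L * T) - 1 := by
    have := Real.add_one_lt_exp (mul_pos hL hT).ne'
    have := mul_pos hL hT
    linarith
  set F : ℝ → ℝ := fun x => ∫ r in (0 : ℝ)..x, Real.exp (L * r) * u r with hF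
  have hcont : Continuous fun r => Real.exp (L * r) * u r := by fun_prop
  have hFd : ∀ x, HasDerivAt F (Real.exp (L * x) * u x) x := fun x =>
    intervalIntegral.integral_hasDerivAt_right (hcont.intervalIntegrable _ _)
      (hcont.stronglyMeasurableAtFilter _ _) hcont.continuousAt
  have key : ∀ x, green L T hL hT u x =
      (Real.exp (L * T) - 1)⁻¹ * (Real.exp (-(L * x)) * (F (x + T) - F x)) := by
    intro x
    rw [green_apply]
    congr 1
    rw [hF]
    simp only
    rw [intervalIntegral.integral_interval_sub_left (hcont.intervalIntegrable _ _)
      (hcont.intervalIntegrable _ _), ← intervalIntegral.integral_const_mul]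
    have := intervalIntegral.integral_comp_add_left (a := 0) (b := T)
      (fun r => Real.exp (-(L * x)) * (Real.exp (L * r) * u r)) x
    rw [add_zero] at this
    rw [← this]
    refine intervalIntegral.integral_congr fun s _ => ?_
    rw [← mul_assoc, ← Real.exp_add]
    congr 2
    ring
  have h1 : HasDerivAt (fun x : ℝ => Real.exp (-(L * x))) (Real.exp (-(L * t)) * (-L)) t := by
    have := ((hasDerivAt_id t).const_mul L).neg.exp
    simpa using this
  have h2 := ((h1.mul (((hFd (t + T)).comp_add_const t T).sub (hFd t))).const_mul
    (Real.exp (L * T) - 1)⁻¹)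
  have h3 : (green L T hL hT u : ℝ → ℝ) = fun x =>
      (Real.exp (L * T) - 1)⁻¹ * (Real.exp (-(L * x)) * (F (x + T) - F x)) := funext key
  rw [key t, h3]
  refine h2.congr_deriv ?_
  have e1 : Real.exp (L * (t + T)) = Real.exp (L * t) * Real.exp (L * T) := by
    rw [← Real.exp_add]; ring_nf
  have e2 : Real.exp (-(L * t)) = (Real.exp (L * t))⁻¹ := Real.exp_neg _
  have := Real.exp_pos (L * t)
  simp only [Pi.sub_apply]
  rw [hu t, e1, e2]
  field_simp

/-- A dissipative Lipschitz scalar equation with periodic forcing has a periodic solution. -/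
theorem exists_periodic_solution_of_dissipative {g p : ℝ → ℝ} {L m T : ℝ} (hm : 0 < m)
    (hT : 0 < T) (hg : ∀ x y, x ≤ y → m * (y - x) ≤ g x - g y ∧ g x - g y ≤ L * (y - x))
    (hp : Continuous p) (hper : Function.Periodic p T) :
    ∃ y : ℝ → ℝ, Function.Periodic y T ∧ ∀ t, HasDerivAt y (g (y t) + p t) t := by
  have hmL : m ≤ L := by
    have := hg 0 1 zero_le_one
    linarith [this.1, this.2]
  have hL : 0 < L := hm.trans_le hmL
  obtain ⟨C, hC⟩ : ∃ C, ∀ t, ‖p t‖ ≤ C := by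
    obtain ⟨C, hC⟩ := (isCompact_Icc (a := (0 : ℝ)) (b := T)).exists_bound_of_continuousOn
      hp.continuousOn
    refine ⟨C, fun t => ?_⟩
    obtain ⟨q, hq, hqt⟩ := hper.exists_mem_Ico₀ hT t
    rw [hqt]
    exact hC q (Ico_subset_Icc_self hq)
  let P : ℝ →ᵇ ℝ := BoundedContinuousFunction.ofNormedAddCommGroup p hp C hC
  let h : ℝ → ℝ := fun x => g x + L * x
  let K : NNReal := ⟨L - m, sub_nonneg.2 hmL⟩
  have hh : LipschitzWith K h := by
    refine LipschitzWith.of_dist_le_mul fun x y => ?_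
    change |h x - h y| ≤ (L - m) * |x - y|
    rcases le_total x y with hxy | hxy
    · obtain ⟨h1, h2⟩ := hg x y hxy
      rw [abs_of_nonpos (sub_nonpos.2 hxy), abs_le]
      constructor <;> simp only [h] <;> nlinarith
    · obtain ⟨h1, h2⟩ := hg y x hxy
      rw [abs_of_nonneg (sub_nonneg.2 hxy), abs_le]
      constructor <;> simp only [h] <;> nlinarith
  let Φ : (ℝ →ᵇ ℝ) → (ℝ →ᵇ ℝ) := fun y => green L T hL hT (y.comp h hh + P)
  let q : NNReal := ⟨(L - m) / L, div_nonneg (sub_nonneg.2 hmL) hL.le⟩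
  have hΦ : ContractingWith q Φ := by
    refine ⟨?_, LipschitzWith.of_dist_le_mul fun y z => ?_⟩
    · rw [← NNReal.coe_lt_coe]
      change (L - m) / L < 1
      rw [div_lt_one hL]
      linarith
    · refine (dist_green_le L T hL hT _ _).trans ?_
      rw [dist_add_right]
      have h1 : dist (y.comp h hh) (z.comp h hh) ≤ (L - m) * dist y z :=
        (BoundedContinuousFunction.lipschitz_comp hh).dist_le_mul y z
      change _ ≤ (L - m) / L * dist y z
      rw [div_mul_eq_mul_div]
      gcongr
  obtain ⟨y, hy⟩ : ∃ y, Φ y = y := ⟨_, hΦ.fixedPoint_isFixedPt⟩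
  have hyper : Function.Periodic y T := by
    let S : (ℝ →ᵇ ℝ) := y.compContinuous ⟨fun t => t + T, by fun_prop⟩
    have hS : Φ S = S := by
      ext t
      change _ = y (t + T)
      conv_rhs => rw [← hy]
      change green L T hL hT _ _ = green L T hL hT _ _
      rw [green_apply, green_apply]
      congr 1
      refine intervalIntegral.integral_congr fun s _ => ?_
      change Real.exp (L * s) * (h (y (t + s + T)) + p (t + s)) =
        Real.exp (L * s) * (h (y (t + T + s)) + p (t + T + s))
      rw [← hper (t + s), show t + s + T = t + T + s by ring]
    have : S = y := hΦ.fixedPoint_unique' hS hy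
    intro t
    exact DFunLike.congr_fun this t
  refine ⟨y, hyper, fun t => ?_⟩
  have hu : Function.Periodic (y.comp h hh + P : ℝ →ᵇ ℝ) T := by
    intro s
    change h (y (s + T)) + p (s + T) = h (y s) + p s
    rw [hyper s, hper s]
  have := hasDerivAt_green L T hL hT _ hu t
  change HasDerivAt (Φ y) (-L * Φ y t + (h (y t) + p t)) t at this
  rw [hy] at this
  refine this.congr_deriv ?_
  simp only [h]
  ring

end Green

/-! ### Elementary properties of the nonlinearity -/

namespace IsContactLaw

variable {f : ℝ → ℝ} {fmin : EReal}

theorem differentiableAt (hf : IsContactLaw f fmin) {y : ℝ} (hy : -1 < y) :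
    DifferentiableAt ℝ f y :=
  (hf.contDiffOn.differentiableOn (by norm_num)).differentiableAt (Ioi_mem_nhds hy)

theorem strictAntiOn (hf : IsContactLaw f fmin) : StrictAntiOn f (Ioi (-1)) :=
  strictAntiOn_of_deriv_neg (convex_Ioi _) hf.contDiffOn.continuousOn
    fun y hy => hf.deriv_neg y (by simpa using hy)

theorem strictMonoOn_deriv (hf : IsContactLaw f fmin) : StrictMonoOn (deriv f) (Ioi (-1)) :=
  strictMonoOn_of_deriv_pos (convex_Ioi _)
    (hf.contDiffOn.continuousOn_deriv_of_isOpen isOpen_Ioi (by norm_num))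
    fun y hy => hf.deriv_deriv_pos y (by simpa using hy)

theorem convexOn (hf : IsContactLaw f fmin) : ConvexOn ℝ (Ioi (-1)) f :=
  (hf.strictMonoOn_deriv.monotoneOn.mono interior_subset).convexOn_of_deriv (convex_Ioi _)
    hf.contDiffOn.continuousOn
    fun y hy => (hf.differentiableAt (by simpa using hy)).differentiableWithinAt

theorem exists_eq_deriv_mul (hf : IsContactLaw f fmin) {y : ℝ} (hy : -1 < y) (h0 : y ≠ 0) :
    ∃ x, -1 < x ∧ |x| ≤ |y| ∧ 0 < x * y ∧ f y = deriv f x * y := by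
  rcases h0.lt_or_gt with hneg | hpos
  · obtain ⟨x, hx, h⟩ := exists_deriv_eq_slope f hneg
      (fun z hz => (hf.differentiableAt (hy.trans_le hz.1)).continuousAt.continuousWithinAt)
      (fun z hz => (hf.differentiableAt (hy.trans hz.1)).differentiableWithinAt)
    refine ⟨x, hy.trans hx.1, ?_, mul_pos_of_neg_of_neg hx.2 hneg, ?_⟩
    · rw [abs_of_neg hx.2, abs_of_neg hneg]; linarith [hx.1]
    · rw [h, hf.map_zero]; field_simp; ring
  · obtain ⟨x, hx, h⟩ := exists_deriv_eq_slope f hpos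
      (fun z hz => (hf.differentiableAt (by linarith [hz.1])).continuousAt.continuousWithinAt)
      (fun z hz => (hf.differentiableAt (by linarith [hz.1])).differentiableWithinAt)
    refine ⟨x, by linarith [hx.1], ?_, mul_pos hx.1 hpos, ?_⟩
    · rw [abs_of_pos hx.1, abs_of_pos hpos]; exact hx.2.le
    · rw [h, hf.map_zero]; field_simp; ring

theorem add_self_pos (hf : IsContactLaw f fmin) {y : ℝ} (hy : -1 < y) (h0 : y ≠ 0) :
    0 < f y + y := by
  obtain ⟨x, hx, -, hxy, h⟩ := hf.exists_eq_deriv_mul hy h0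
  rw [h, ← add_one_mul]
  rcases pos_and_pos_or_neg_and_neg_of_mul_pos hxy with ⟨h1, h2⟩ | ⟨h1, h2⟩
  · have := hf.strictMonoOn_deriv (show (0 : ℝ) ∈ Ioi (-1) by simp) hx h1
    rw [hf.deriv_zero] at this
    exact mul_pos (by linarith) h2
  · have := hf.strictMonoOn_deriv hx (show (0 : ℝ) ∈ Ioi (-1) by simp) h1
    rw [hf.deriv_zero] at this
    exact mul_pos_of_neg_of_neg (by linarith) h2

theorem add_self_nonneg (hf : IsContactLaw f fmin) {y : ℝ} (hy : -1 < y) : 0 ≤ f y + y := by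
  rcases eq_or_ne y 0 with rfl | h0
  · simp [hf.map_zero]
  · exact (hf.add_self_pos hy h0).le

theorem exists_quadratic_bound (hf : IsContactLaw f fmin) :
    ∃ C δ : ℝ, 0 ≤ C ∧ 0 < δ ∧ ∀ y, -1 < y → |y| < δ → f y + y ≤ C * y ^ 2 := by
  have hd : DifferentiableAt ℝ (deriv f) 0 :=
    differentiableAt_of_deriv_ne_zero (hf.deriv_deriv_pos 0 (by norm_num)).ne'
  obtain ⟨C, hC, hb⟩ := hd.isBigO_sub.exists_nonneg
  obtain ⟨δ, hδ, h⟩ := Metric.eventually_nhds_iff.1 hb.bound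
  refine ⟨C, δ, hC, hδ, fun y hy hyδ => ?_⟩
  rcases eq_or_ne y 0 with rfl | h0
  · simp [hf.map_zero]
  obtain ⟨x, hx, hxy, -, he⟩ := hf.exists_eq_deriv_mul hy h0
  have h1 : |deriv f x + 1| ≤ C * |x| := by
    have := h (y := x) (by simpa using hxy.trans_lt hyδ)
    simpa [hf.deriv_zero] using this
  rw [he, ← add_one_mul]
  calc (deriv f x + 1) * y ≤ |deriv f x + 1| * |y| := by rw [← abs_mul]; exact le_abs_self _
    _ ≤ C * |y| * |y| := by gcongr; exact h1.trans (by gcongr)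
    _ = C * y ^ 2 := by rw [mul_assoc, abs_mul_abs_self, sq]

theorem slope_bounds (hf : IsContactLaw f fmin) {a b x y : ℝ} (ha : -1 < a) (hax : a ≤ x)
    (hxy : x ≤ y) (hyb : y ≤ b) :
    -deriv f b * (y - x) ≤ f x - f y ∧ f x - f y ≤ -deriv f a * (y - x) := by
  have hm : ∀ {z}, z ∈ Icc a b → -1 < z := fun hz => ha.trans_le hz.1
  have hc : ContinuousOn f (Icc a b) := fun z hz =>
    (hf.differentiableAt (hm hz)).continuousAt.continuousWithinAt
  have hd : DifferentiableOn ℝ f (interior (Icc a b)) := fun z hz =>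
    (hf.differentiableAt (hm (interior_subset hz))).differentiableWithinAt
  have hxm : x ∈ Icc a b := ⟨hax, hxy.trans hyb⟩
  have hym : y ∈ Icc a b := ⟨hax.trans hxy, hyb⟩
  have hab : a ≤ b := hax.trans hxm.2
  have h1 := (convex_Icc a b).image_sub_le_mul_sub_of_deriv_le hc hd (C := deriv f b)
    (fun z hz => hf.strictMonoOn_deriv.monotoneOn (hm (interior_subset hz)) (ha.trans_le hab)
      (interior_subset hz).2) x hxm y hym hxy
  have h2 := (convex_Icc a b).mul_sub_le_image_sub_of_le_deriv hc hd (C := deriv f a)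
    (fun z hz => hf.strictMonoOn_deriv.monotoneOn ha (hm (interior_subset hz))
      (interior_subset hz).1) x hxm y hym hxy
  constructor <;> linarith

theorem lt_of_coe_eq (hf : IsContactLaw f fmin) {r y : ℝ} (hr : fmin = r) (hy : -1 < y) :
    r < f y := by
  have : (f y : EReal) ∈ Ioo fmin ⊤ := hf.image_eq ▸ mem_image_of_mem _ hy
  rw [hr] at this
  exact EReal.coe_lt_coe_iff.1 this.1

end IsContactLaw

/-! ### Periodic solutions -/

theorem periodic_sin_mul {ω : ℝ} (hω : 0 < ω) :
    Function.Periodic (fun t => Real.sin (ω * t)) (2 * Real.pi / ω) := fun t => by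
  change Real.sin (ω * (t + 2 * Real.pi / ω)) = _
  rw [mul_add, mul_div_cancel₀ _ hω.ne', Real.sin_add_two_pi]

theorem periodic_cos_mul {ω : ℝ} (hω : 0 < ω) :
    Function.Periodic (fun t => Real.cos (ω * t)) (2 * Real.pi / ω) := fun t => by
  change Real.cos (ω * (t + 2 * Real.pi / ω)) = _
  rw [mul_add, mul_div_cancel₀ _ hω.ne', Real.cos_add_two_pi]

theorem period_pos {ω : ℝ} (hω : 0 < ω) : 0 < 2 * Real.pi / ω := by positivity

theorem hasDerivAt_mul_cos {ω : ℝ} (hω : 0 < ω) (A t : ℝ) :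
    HasDerivAt (fun t => A / ω * Real.cos (ω * t)) (-(A * Real.sin (ω * t))) t := by
  have := (((hasDerivAt_id t).const_mul ω).cos).const_mul (A / ω)
  refine this.congr_deriv ?_
  simp only [id]
  field_simp

/-- The absorbed primitive of the forcing bounds periodic solutions from above. -/
theorem add_cos_le_of_periodic {g y : ℝ → ℝ} {ω A : ℝ} (hω : 0 < ω) (hA : 0 ≤ A)
    (hg : ∀ t, g (y t) = 0 → y t = 0)
    (hy : ∀ t, HasDerivAt y (g (y t) + A * Real.sin (ω * t)) t)
    (hper : Function.Periodic y (2 * Real.pi / ω)) (t : ℝ) :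
    y t + A / ω * Real.cos (ω * t) ≤ A / ω := by
  have h := nonneg_of_periodic (d := fun t => A / ω - (y t + A / ω * Real.cos (ω * t)))
    (d' := fun t => -g (y t)) (period_pos hω)
    (fun t => by
      change A / ω - (y (t + _) + A / ω * Real.cos (ω * (t + _))) = _
      have hcos : Real.cos (ω * (t + 2 * Real.pi / ω)) = Real.cos (ω * t) :=
        periodic_cos_mul hω t
      rw [hper t, hcos])
    (fun t => by
      have := ((hy t).add (hasDerivAt_mul_cos hω A t)).const_sub (A / ω)
      refine this.congr_deriv ?_
      ring)
    (fun t ht => by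
      have h0 := hg t (neg_eq_zero.1 ht)
      change 0 ≤ A / ω - (y t + A / ω * Real.cos (ω * t))
      rw [h0]
      have := mul_le_mul_of_nonneg_left (Real.cos_le_one (ω * t)) (div_nonneg hA hω.le)
      linarith) t
  linarith

namespace IsContactLaw

variable {f : ℝ → ℝ} {fmin : EReal}

theorem exists_isPeriodicSolution (hf : IsContactLaw f fmin) {ω A : ℝ} (hω : 0 < ω)
    (hA : 0 ≤ A) : ∃ y, IsPeriodicSolution f ω A y := by
  obtain ⟨a, hfa, ha⟩ : ∃ a, A ≤ f a ∧ a ∈ Ioo (-1 : ℝ) 0 :=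
    ((hf.tendsto_neg_one.eventually_ge_atTop A).and
      (Ioo_mem_nhdsGT (by norm_num : (-1 : ℝ) < 0))).exists
  set b := 2 * A / ω with hb
  have hb0 : 0 ≤ b := by positivity
  have hab : a ≤ b := ha.2.le.trans hb0
  set m := -deriv f b with hm
  have hm0 : 0 < m := neg_pos.2 (hf.deriv_neg b (by linarith [ha.1]))
  have hmL : m ≤ -deriv f a :=
    neg_le_neg (hf.strictMonoOn_deriv.monotoneOn ha.1 (ha.1.trans_le hab) hab)
  let c : ℝ → ℝ := fun x => max a (min b x)
  let g : ℝ → ℝ := fun x => f (c x) - m * (x - c x)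
  have hc : ∀ x y, x ≤ y → c x ≤ c y ∧ x - c x ≤ y - c y := by
    intro x y hxy
    refine ⟨max_le_max le_rfl (min_le_min le_rfl hxy), ?_⟩
    simp only [c]
    rcases max_cases a (min b x) with h1 | h1 <;> rcases max_cases a (min b y) with h2 | h2 <;>
    rcases min_cases b x with h3 | h3 <;> rcases min_cases b y with h4 | h4 <;> linarith
  have hca : ∀ x, a ≤ c x := fun x => le_max_left _ _
  have hcb : ∀ x, c x ≤ b := fun x => max_le hab (min_le_left _ _)
  have hcid : ∀ x, a ≤ x → x ≤ b → c x = x := fun x h1 h2 => by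
    simp only [c]; rw [min_eq_right h2, max_eq_right h1]
  have hgf : ∀ x, a ≤ x → x ≤ b → g x = f x := fun x h1 h2 => by
    simp only [g]; rw [hcid x h1 h2]; ring
  have hg : ∀ x y, x ≤ y → m * (y - x) ≤ g x - g y ∧ g x - g y ≤ -deriv f a * (y - x) := by
    intro x y hxy
    obtain ⟨h1, h2⟩ := hc x y hxy
    obtain ⟨h3, h4⟩ := hf.slope_bounds ha.1 (hca x) h1 (hcb y)
    constructor <;> simp only [g] <;> nlinarith
  obtain ⟨y, hper, hy⟩ := exists_periodic_solution_of_dissipative hm0 (period_pos hω) hg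
    (p := fun t => A * Real.sin (ω * t)) (by fun_prop)
    (fun t => congrArg (A * ·) (periodic_sin_mul hω t))
  have hlow : ∀ t, a ≤ y t := by
    intro t
    have := nonneg_of_periodic (d := fun t => y t - a) (period_pos hω)
      (fun t => congrArg (· - a) (hper t)) (fun t => (hy t).sub_const a)
      (fun t ht => by
        by_contra! hlt
        have h1 := (hg (y t) a (by linarith)).1
        rw [hgf a le_rfl hab] at h1
        have h2 := mul_le_mul_of_nonneg_left (Real.neg_one_le_sin (ω * t)) hA
        nlinarith) t
    linarith
  have hup : ∀ t, y t ≤ b := by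
    intro t
    have := add_cos_le_of_periodic hω hA (g := g) (fun t ht => by
      have h0 : g 0 = 0 := by rw [hgf 0 ha.2.le hb0, hf.map_zero]
      rcases le_total (y t) 0 with h | h
      · have := (hg _ _ h).1
        nlinarith
      · have := (hg _ _ h).1
        nlinarith) hy hper t
    have h2 := mul_le_mul_of_nonneg_left (Real.neg_one_le_cos (ω * t)) (div_nonneg hA hω.le)
    have h3 : b = A / ω + A / ω := by rw [hb]; ring
    linarith
  exact ⟨y, fun t => ha.1.trans_le (hlow t), fun t => hgf _ (hlow t) (hup t) ▸ hy t, hper⟩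

end IsContactLaw

/-- The amplitude-one periodic solution of the linearized equation. -/
noncomputable def linearResponse (ω t : ℝ) : ℝ :=
  1 / Real.sqrt (1 + ω ^ 2) * Real.sin (ω * t - Real.arctan ω)

theorem hasDerivAt_linearResponse (ω t : ℝ) :
    HasDerivAt (linearResponse ω) (-linearResponse ω t + Real.sin (ω * t)) t := by
  have h := ((((hasDerivAt_id t).const_mul ω).sub_const (Real.arctan ω)).sin).const_mul
    (1 / Real.sqrt (1 + ω ^ 2))
  refine h.congr_deriv ?_
  have hs : 0 < Real.sqrt (1 + ω ^ 2) := by positivity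
  have hsq : Real.sqrt (1 + ω ^ 2) ^ 2 = 1 + ω ^ 2 := Real.sq_sqrt (by positivity)
  have e : Real.sin (ω * t) = Real.sin (ω * t - Real.arctan ω) * (1 / Real.sqrt (1 + ω ^ 2)) +
      Real.cos (ω * t - Real.arctan ω) * (ω / Real.sqrt (1 + ω ^ 2)) := by
    rw [← Real.cos_arctan, ← Real.sin_arctan, ← Real.sin_add, sub_add_cancel]
  rw [e]
  simp only [linearResponse, id]
  ring

theorem periodic_linearResponse {ω : ℝ} (hω : 0 < ω) :
    Function.Periodic (linearResponse ω) (2 * Real.pi / ω) := fun t => by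
  simp only [linearResponse]
  rw [mul_add, mul_div_cancel₀ _ hω.ne', add_sub_right_comm, Real.sin_add_two_pi]

theorem abs_linearResponse_le (ω t : ℝ) :
    |linearResponse ω t| ≤ 1 / Real.sqrt (1 + ω ^ 2) := by
  have : 0 ≤ 1 / Real.sqrt (1 + ω ^ 2) := by positivity
  rw [linearResponse, abs_mul, abs_of_nonneg this]
  exact mul_le_of_le_one_right this (Real.abs_sin_le_one _)

namespace IsPeriodicSolution

variable {f : ℝ → ℝ} {fmin : EReal} {ω A : ℝ} {y : ℝ → ℝ}

theorem continuous (hy : IsPeriodicSolution f ω A y) : Continuous y :=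
  continuous_iff_continuousAt.2 fun t => (hy.hasDerivAt t).continuousAt

theorem le_supersolution (hf : IsContactLaw f fmin) (hω : 0 < ω)
    (hy : IsPeriodicSolution f ω A y) {w w' : ℝ → ℝ} (hw1 : ∀ t, -1 < w t)
    (hw : ∀ t, HasDerivAt w (w' t) t) (hper : Function.Periodic w (2 * Real.pi / ω))
    (hle : ∀ t, f (w t) + A * Real.sin (ω * t) ≤ w' t) (t : ℝ) : y t ≤ w t := by
  have := nonneg_of_periodic (d := fun t => w t - y t) (period_pos hω)
    (fun t => by change w (t + _) - y (t + _) = _; rw [hper t, hy.periodic t])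
    (fun t => (hw t).sub (hy.hasDerivAt t))
    (fun t ht => by
      by_contra! hlt
      have := hf.strictAntiOn (hw1 t) (hy.neg_one_lt t) (by linarith)
      linarith [hle t]) t
  linarith

theorem unique (hf : IsContactLaw f fmin) (hω : 0 < ω) (hy : IsPeriodicSolution f ω A y)
    {z : ℝ → ℝ} (hz : IsPeriodicSolution f ω A z) : y = z :=
  funext fun t => le_antisymm
    (hy.le_supersolution hf hω hz.neg_one_lt hz.hasDerivAt hz.periodic (fun _ => le_rfl) t)
    (hz.le_supersolution hf hω hy.neg_one_lt hy.hasDerivAt hy.periodic (fun _ => le_rfl) t)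

/-- Periodic solutions are pointwise convex in the amplitude. -/
theorem le_convex_combination (hf : IsContactLaw f fmin) (hω : 0 < ω) {B a b : ℝ} {z x : ℝ → ℝ}
    (hy : IsPeriodicSolution f ω A y) (hz : IsPeriodicSolution f ω B z)
    (hx : IsPeriodicSolution f ω (a * A + b * B) x) (ha : 0 ≤ a) (hb : 0 ≤ b) (hab : a + b = 1)
    (t : ℝ) : x t ≤ a * y t + b * z t := by
  refine hx.le_supersolution hf hω (w := fun t => a * y t + b * z t)
    (fun t => convex_Ioi (-1 : ℝ) (hy.neg_one_lt t) (hz.neg_one_lt t) ha hb hab)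
    (fun t => ((hy.hasDerivAt t).const_mul a).add ((hz.hasDerivAt t).const_mul b))
    (fun t => by
      change a * y (t + _) + b * z (t + _) = _
      rw [hy.periodic t, hz.periodic t])
    (fun t => ?_) t
  have := hf.convexOn.2 (hy.neg_one_lt t) (hz.neg_one_lt t) ha hb hab
  simp only [smul_eq_mul] at this
  linarith

theorem eq_zero_of_map_eq_zero (hf : IsContactLaw f fmin) (hy : IsPeriodicSolution f ω A y)
    (t : ℝ) (h : f (y t) = 0) : y t = 0 :=
  hf.strictAntiOn.injOn (hy.neg_one_lt t) (show (0 : ℝ) ∈ Ioi (-1) by simp)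
    (h.trans hf.map_zero.symm)

theorem le_two_mul_div (hf : IsContactLaw f fmin) (hω : 0 < ω) (hA : 0 ≤ A)
    (hy : IsPeriodicSolution f ω A y) (t : ℝ) : y t ≤ 2 * A / ω := by
  have := add_cos_le_of_periodic hω hA (hy.eq_zero_of_map_eq_zero hf) hy.hasDerivAt hy.periodic t
  have h2 := mul_le_mul_of_nonneg_left (Real.neg_one_le_cos (ω * t)) (div_nonneg hA hω.le)
  have h3 : 2 * A / ω = A / ω + A / ω := by ring
  linarith

theorem lt_two_mul_div (hf : IsContactLaw f fmin) (hω : 0 < ω) (hA : 0 < A)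
    (hy : IsPeriodicSolution f ω A y) (t : ℝ) : y t < 2 * A / ω := by
  refine lt_of_le_of_ne (hy.le_two_mul_div hf hω hA.le t) fun heq => ?_
  have hle := add_cos_le_of_periodic hω hA.le (hy.eq_zero_of_map_eq_zero hf) hy.hasDerivAt
    hy.periodic
  have h2 := mul_le_mul_of_nonneg_left (Real.neg_one_le_cos (ω * t)) (div_nonneg hA.le hω.le)
  have h3 : 2 * A / ω = A / ω + A / ω := by ring
  have hmax : ∀ s, y s + A / ω * Real.cos (ω * s) ≤ y t + A / ω * Real.cos (ω * t) :=
    fun s => (hle s).trans (by linarith)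
  have h0 := IsLocalMax.hasDerivAt_eq_zero (Eventually.of_forall hmax)
    ((hy.hasDerivAt t).add (hasDerivAt_mul_cos hω A t))
  have := hy.eq_zero_of_map_eq_zero hf t (by linarith)
  have : 0 < 2 * A / ω := by positivity
  linarith

theorem linearResponse_le (hf : IsContactLaw f fmin) (hω : 0 < ω)
    (hy : IsPeriodicSolution f ω A y) (t : ℝ) : A * linearResponse ω t ≤ y t := by
  have := nonneg_of_periodic (d := fun t => y t - A * linearResponse ω t) (period_pos hω)
    (fun t => by
      change y (t + _) - A * linearResponse ω (t + _) = _
      rw [hy.periodic t, periodic_linearResponse hω t])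
    (fun t => (hy.hasDerivAt t).sub ((hasDerivAt_linearResponse ω t).const_mul A))
    (fun t ht => by
      have := hf.add_self_nonneg (hy.neg_one_lt t)
      linarith) t
  linarith

theorem exists_amplitude_lt (hf : IsContactLaw f fmin) (hω : 0 < ω) (hA : 0 < A)
    (hy : IsPeriodicSolution f ω A y) : ∃ t, A / Real.sqrt (1 + ω ^ 2) < y t := by
  set t := (Real.arctan ω + Real.pi / 2) / ω with ht
  have hr : A * linearResponse ω t = A / Real.sqrt (1 + ω ^ 2) := by
    rw [linearResponse, ht, mul_div_cancel₀ _ hω.ne', add_sub_cancel_left, Real.sin_pi_div_two]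
    ring
  refine ⟨t, lt_of_le_of_ne (hr ▸ hy.linearResponse_le hf hω t) fun heq => ?_⟩
  have hpos : 0 < A / Real.sqrt (1 + ω ^ 2) := by positivity
  have hmin : ∀ s, y t - A * linearResponse ω t ≤ y s - A * linearResponse ω s := fun s => by
    have := hy.linearResponse_le hf hω s
    linarith
  have h0 := IsLocalMin.hasDerivAt_eq_zero (Eventually.of_forall hmin)
    ((hy.hasDerivAt t).sub ((hasDerivAt_linearResponse ω t).const_mul A))
  have := hf.add_self_pos (hy.neg_one_lt t) (by rw [← heq]; exact hpos.ne')
  linarith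

theorem exists_le_of_lower_bound (hf : IsContactLaw f fmin) (hω : 0 < ω)
    (hy : IsPeriodicSolution f ω A y) {r : ℝ} (hr : ∀ x, -1 < x → r < f x) :
    ∃ t, 2 * (A / ω * (1 / Real.sqrt (1 + ω ^ 2))) + Real.pi / ω * r ≤ y t := by
  have hd : ∀ t, HasDerivAt (fun t => y t + A / ω * Real.cos (ω * t) - r * t)
      (f (y t) - r) t := fun t => by
    have := ((hy.hasDerivAt t).add (hasDerivAt_mul_cos hω A t)).sub
      ((hasDerivAt_id t).const_mul r)
    refine this.congr_deriv ?_
    ring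
  have hmono : Monotone fun t => y t + A / ω * Real.cos (ω * t) - r * t :=
    monotone_of_deriv_nonneg (fun t => (hd t).differentiableAt) fun t => by
      rw [(hd t).deriv]
      exact sub_nonneg.2 (hr _ (hy.neg_one_lt t)).le
  set t := Real.arctan ω / ω with ht
  have h1 : ω * t = Real.arctan ω := mul_div_cancel₀ _ hω.ne'
  have h2 : ω * (t + Real.pi / ω) = Real.arctan ω + Real.pi := by
    rw [mul_add, h1, mul_div_cancel₀ _ hω.ne']
  have h0 : 0 ≤ y t := by
    have := hy.linearResponse_le hf hω t
    rwa [linearResponse, h1, sub_self, Real.sin_zero, mul_zero, mul_zero] at this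
  have h3 := hmono (show t ≤ t + Real.pi / ω by linarith [div_pos Real.pi_pos hω])
  simp only at h3
  rw [h2, h1, Real.cos_add_pi, Real.cos_arctan] at h3
  exact ⟨t + Real.pi / ω, by linarith⟩

/-- A uniform bound on `f y + y` along the solution controls the deviation from the linear
response. -/
theorem le_linearResponse_add (hω : 0 < ω) (hy : IsPeriodicSolution f ω A y) {c : ℝ}
    (hc : ∀ t, f (y t) + y t ≤ c) (t : ℝ) : y t ≤ A * linearResponse ω t + c := by
  have := nonneg_of_periodic (d := fun t => A * linearResponse ω t + c - y t) (period_pos hω)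
    (fun t => by
      change A * linearResponse ω (t + _) + c - y (t + _) = _
      rw [hy.periodic t, periodic_linearResponse hω t])
    (fun t => (((hasDerivAt_linearResponse ω t).const_mul A).add_const c).sub (hy.hasDerivAt t))
    (fun t ht => by linarith [hc t]) t
  linarith

theorem exists_quadratic_deviation (hf : IsContactLaw f fmin) (hω : 0 < ω) :
    ∃ K ε : ℝ, 0 < ε ∧ ∀ A y, 0 ≤ A → A < ε → IsPeriodicSolution f ω A y →
      ∀ t, y t ≤ A / Real.sqrt (1 + ω ^ 2) + K * A ^ 2 := by
  obtain ⟨C, δ, hC, hδ, hb⟩ := hf.exists_quadratic_bound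
  have hM : 0 < 1 + 2 / ω := by positivity
  refine ⟨C * (1 + 2 / ω) ^ 2, δ / (1 + 2 / ω), by positivity, fun A y hA hAε hy t => ?_⟩
  have hs : 1 / Real.sqrt (1 + ω ^ 2) ≤ 1 := by
    rw [div_le_one (by positivity), Real.one_le_sqrt]
    nlinarith
  have habs : ∀ s, |y s| ≤ (1 + 2 / ω) * A := fun s => by
    have h1 := hy.linearResponse_le hf hω s
    have h2 := hy.le_two_mul_div hf hω hA s
    have h3 := mul_le_mul_of_nonneg_left
      ((abs_le.1 ((abs_linearResponse_le ω s).trans hs)).1) hA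
    have h4 : (1 + 2 / ω) * A = A + 2 * A / ω := by ring
    have h5 : 0 ≤ 2 * A / ω := by positivity
    rw [abs_le, h4]
    constructor <;> linarith
  have hc : ∀ s, f (y s) + y s ≤ C * (1 + 2 / ω) ^ 2 * A ^ 2 := fun s => by
    refine (hb _ (hy.neg_one_lt s) ((habs s).trans_lt ?_)).trans ?_
    · rw [lt_div_iff₀ hM] at hAε
      linarith
    · rw [mul_assoc, ← mul_pow, ← sq_abs (y s)]
      gcongr
      exact habs s
  refine (hy.le_linearResponse_add hω hc t).trans ?_
  have h3 := mul_le_mul_of_nonneg_left (abs_le.1 (abs_linearResponse_le ω t)).2 hA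
  rw [mul_one_div] at h3
  linarith

end IsPeriodicSolution

theorem theorem5p6 (f : ℝ → ℝ) (fmin : EReal) (hf : IsContactLaw f fmin)
    (ω : ℝ) (hω : 0 < ω) :
    -- for each forcing amplitude there is exactly one periodic solution
    (∀ A : ℝ, 0 ≤ A → ∃! y : ℝ → ℝ, IsPeriodicSolution f ω A y) ∧
    ∀ Y : ℝ → ℝ → ℝ, (∀ A : ℝ, 0 ≤ A → IsPeriodicSolution f ω A (Y A)) →
      ∃ Ymax : ℝ → ℝ,
        -- `Ymax A` is the maximum of the periodic solution over one period
        (∀ A : ℝ, 0 ≤ A → IsGreatest (Y A '' Icc 0 (2 * Real.pi / ω)) (Ymax A)) ∧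
        StrictMonoOn Ymax (Ici 0) ∧
        ConvexOn ℝ (Ici 0) Ymax ∧
        (∀ A : ℝ, 0 < A →
          max ((A / Real.sqrt (1 + ω ^ 2) : ℝ) : EReal)
              (((A / ω * (1 / Real.sqrt (1 + ω ^ 2)) : ℝ) : EReal)
                - ((2 * Real.pi / ω / 2 : ℝ) : EReal) * ((fmin.abs : ℝ≥0∞) : EReal))
            < ((Ymax A : ℝ) : EReal) ∧
          Ymax A < 2 * A / ω) ∧
        (fun A : ℝ => Ymax A - A / Real.sqrt (1 + ω ^ 2)) =O[𝓝[≥] 0] (fun A : ℝ => A ^ 2) := by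
  refine ⟨fun A hA => ?_, fun Y hY => ?_⟩
  · obtain ⟨y, hy⟩ := hf.exists_isPeriodicSolution hω hA
    exact ⟨y, hy, fun z hz => hz.unique hf hω hy⟩
  have hT := period_pos hω
  have hgreat : ∀ A, 0 ≤ A → ∃ M, IsGreatest (Y A '' Icc 0 (2 * Real.pi / ω)) M := fun A hA =>
    (isCompact_Icc.image (hY A hA).continuous).exists_isGreatest
      ((nonempty_Icc.2 hT.le).image _)
  choose! M hM using hgreat
  have hle : ∀ A, 0 ≤ A → ∀ t, Y A t ≤ M A := fun A hA t => by
    obtain ⟨s, hs, hst⟩ := (hY A hA).periodic.exists_mem_Ico₀ hT t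
    rw [hst]
    exact (hM A hA).2 (mem_image_of_mem _ (Ico_subset_Icc_self hs))
  have hex : ∀ A, 0 ≤ A → ∃ t, Y A t = M A := fun A hA => by
    obtain ⟨t, -, ht⟩ := (hM A hA).1
    exact ⟨t, ht⟩
  have hlow : ∀ A, 0 < A → A / Real.sqrt (1 + ω ^ 2) < M A := fun A hA => by
    obtain ⟨t, ht⟩ := (hY A hA.le).exists_amplitude_lt hf hω hA
    exact ht.trans_le (hle A hA.le t)
  have hpos : ∀ A, 0 < A → 0 < M A := fun A hA =>
    lt_trans (by positivity) (hlow A hA)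
  have hzero : M 0 = 0 := by
    obtain ⟨t, ht⟩ := hex 0 le_rfl
    have h1 := (hY 0 le_rfl).le_two_mul_div hf hω le_rfl t
    have h2 := (hY 0 le_rfl).linearResponse_le hf hω t
    simp only [mul_zero, zero_div, zero_mul] at h1 h2
    linarith
  have hconv : ConvexOn ℝ (Ici 0) M := by
    refine ⟨convex_Ici 0, fun A hA B hB a b ha hb hab => ?_⟩
    have hAB : 0 ≤ a * A + b * B := convex_Ici 0 hA hB ha hb hab
    simp only [smul_eq_mul]
    obtain ⟨t, ht⟩ := hex _ hAB
    rw [← ht]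
    refine ((hY A hA).le_convex_combination hf hω (hY B hB) (hY _ hAB) ha hb hab t).trans ?_
    gcongr
    · exact hle A hA t
    · exact hle B hB t
  refine ⟨M, hM, fun A hA B hB hAB => ?_, hconv, fun A hA => ⟨?_, ?_⟩, ?_⟩
  · have hB0 : 0 < B := lt_of_le_of_lt hA hAB
    have h := hconv.2 hB (show (0 : ℝ) ∈ Ici 0 by simp) (div_nonneg hA hB0.le)
      (sub_nonneg.2 ((div_le_one hB0).2 hAB.le)) (by ring)
    simp only [smul_eq_mul, mul_zero, add_zero, hzero, div_mul_cancel₀ _ hB0.ne'] at h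
    exact h.trans_lt (mul_lt_of_lt_one_left (hpos B hB0) ((div_lt_one hB0).2 hAB))
  · refine max_lt (EReal.coe_lt_coe_iff.2 (hlow A hA)) ?_
    induction fmin with
    | bot =>
      rw [EReal.abs_bot, EReal.coe_ennreal_top, EReal.coe_mul_top_of_pos (by positivity),
        EReal.sub_top]
      exact EReal.bot_lt_coe _
    | top => exact absurd hf.fmin_neg (by simp)
    | coe r =>
      have hr0 : r < 0 := by exact_mod_cast hf.fmin_neg
      obtain ⟨t, ht⟩ := (hY A hA.le).exists_le_of_lower_bound hf hω
        (fun x hx => hf.lt_of_coe_eq rfl hx)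
      have h1 := hle A hA.le t
      have h2 : 0 < A / ω * (1 / Real.sqrt (1 + ω ^ 2)) := by positivity
      rw [EReal.abs_def, EReal.coe_ennreal_ofReal, max_eq_left (abs_nonneg r), abs_of_neg hr0,
        ← EReal.coe_mul, ← EReal.coe_sub, EReal.coe_lt_coe_iff]
      have h3 : 2 * Real.pi / ω / 2 * -r = -(Real.pi / ω * r) := by ring
      linarith
  · obtain ⟨t, ht⟩ := hex A hA.le
    exact ht ▸ (hY A hA.le).lt_two_mul_div hf hω hA t
  · obtain ⟨K, ε, hε, hK⟩ := IsPeriodicSolution.exists_quadratic_deviation hf hω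
    refine IsBigO.of_bound K ?_
    filter_upwards [self_mem_nhdsWithin, mem_nhdsWithin_of_mem_nhds (Iio_mem_nhds hε)]
      with A hA hAε
    obtain ⟨t, ht⟩ := hex A hA
    have h1 := hK A (Y A) hA hAε (hY A hA) t
    have h2 : A / Real.sqrt (1 + ω ^ 2) ≤ M A := by
      rcases (show 0 ≤ A from hA).eq_or_lt with h | h
      · rw [← h, hzero, zero_div]
      · exact (hlow A h).le
    rw [Real.norm_of_nonneg (sub_nonneg.2 h2), Real.norm_of_nonneg (sq_nonneg A)]
    linarith
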